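/- **Setting.** A probabilistic control-flow graph (pCFG) $\mathcal C$ consists of a finite set $L$ of locations, real program variables $x_1,\dots,x_n$ of which $x_1,\dots,x_m$ ($m\le n$) are output variables (for $\mathbf x\in\mathbb R^n$ write $\mathbf x^{out}\in\mathbb R^m$ for the projection), an initial location $\ell_{init}$ and valuation $\mathbf x_{init}\in\mathbb R^n$, a terminal location $\ell_{out}$, and a finite set of transitions $\tau=(\ell,Pr)$ with source $\ell\in L$ and a probability distribution $Pr$ on $L$. Each $\tau$ carries a guard $G(\tau)$ (a predicate: a finite Boolean combination of inequalities between Borel-measurable expressions) and an update $(j,u)$ of one variable $x_j$, where $u$ is "no update", a Borel-measurable expression assigned to $x_j$, or a probability distribution on $\mathbb R$ from which $x_j$ is sampled. At each location the guards of the outgoing transitions cover $\mathbb R^n$ and are pairwise exclusive; the only transition from $\ell_{out}$ is a self-loop with guard true and no update. $Next(\tau,\mathbf x)$ is the random valuation obtained by applying the update of $\tau$ to $\mathbf x$. $\mathcal C$ defines a Markov process $Z_i=(\ell_i,\mathbf X_i)$ started in $(\ell_{init},\mathbf x_{init})$: in a state the unique enabled transition $\tau=(\ell,Pr)$ is taken,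 the next location is sampled from $Pr$ and, independently, the next valuation from $Next(\tau,\mathbf x)$. A run is a sequence of states starting in the initial state in which each state is a possible successor of the previous one (the new location has positive probability, a sampled value lies in the support of its distribution); a state is reachable if it ends a finite path of this kind. $TimeTerm$ is the first $i$ with $\ell_i=\ell_{out}$ ($\infty$ if there is none); $\mathcal C$ terminates almost surely if $\mathbb P(TimeTerm<\infty)=1$, and then its output distribution $\mu$ is the law of $\mathbf X_{TimeTerm}^{out}$ on $\mathbb R^m$. A state function $\eta$ assigns to each location a Borel-measurable function $\eta(\ell,\cdot):\mathbb R^n\to\mathbb R$. An invariant $I$ assigns to each location a predicate such that $\mathbf x\models I(\ell)$ for every reachable $(\ell,\mathbf x)$. For Borel $f:\mathbb R^m\to\mathbb R$, a UESM for $f$ w.r.t. $I$ is a state function $U_f$ with (1) $U_f(\ell_{out},\mathbf x)=0$ whenever $\mathbf x\models I(\ell_{out})$, and (2) for every transition $\tau=(\ell,Pr)$ and every $\mathbf x\models I(\ell)\wedge G(\tau)$, with $\mathbf N=Next(\tau,\mathbf x)$, $$U_f(\ell,\mathbf x)\ \ge\ \sum_{\ell'\in L}Pr(\ell')\,\mathbb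 E\big[U_f(\ell',\mathbf N)+f(\mathbf N^{out})\big]-f(\mathbf x^{out}),$$ where the sum is taken over the $\ell'$ with $Pr(\ell')>0$ and is required to be well defined in $[-\infty,\infty]$. An LESM $L_f$ is defined in the same way with $\le$ in place of $\ge$. For a state function $\eta$ put $Y_i=\eta(Z_i)+f(\mathbf X_i^{out})$, and let $\mathcal F_t$ be the $\sigma$-algebra generated by $Z_0,\dots,Z_t$. The triple $(\mathcal C,\eta,f)$ is OST-sound if $\mathbb E|Y_i|<\infty$ for all $i\ge 0$ and at least one of the following holds: * (C1) there is a constant $c$ with $TimeTerm\le c$ almost surely; * (C2) there is a constant $c$ with $|Y_{\min\{t,TimeTerm(\rho)\}}(\rho)|\le c$ for all $t\in\mathbb N$ and all runs $\rho$; * (C3) $\mathbb E[TimeTerm]<\infty$, $\mathbb E|Y_0|<\infty$, and there is a constant $c$ with $\mathbb E[|Y_{t+1}-Y_t|\mid\mathcal F_t]\le c$ almost surely for all $t\in\mathbb N$; * (C4) there are real numbers $M,c_1,c_2,d$ with $c_2>0$ such that $\mathbb P(TimeTerm>k)\le c_1e^{-c_2k}$ for all sufficiently large $k\in\mathbb N$,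 and $|Y_{k+1}-Y_k|\le M k^d$ almost surely for all $k\ge 1$. **Theorem 1 (Soundness of U/LESMs).** Let $\mathcal C$ be an almost-surely terminating pCFG with output distribution $\mu$, and let $f:\mathbb R^m\to\mathbb R$ be Borel measurable. Let $U_f$ be a UESM and $L_f$ an LESM for $f$, each with respect to some invariant, and assume that $(\mathcal C,U_f,f)$ and $(\mathcal C,L_f,f)$ are OST-sound. Then $\mathbb E_\mu[f]$ is well defined (that is, $f$ is $\mu$-integrable) and $$U_f(\ell_{init},\mathbf x_{init})+f(\mathbf x_{init}^{out})\ \ge\ \mathbb E_\mu[f]\ \ge\ L_f(\ell_{init},\mathbf x_{init})+f(\mathbf x_{init}^{out}).$$ -/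

import Mathlib

open MeasureTheory ProbabilityTheory Filter
open scoped ENNReal

/-! ## Expressions, predicates, updates -/

/-- An arithmetic expression over `n` real program variables, through its value function:
a Borel-measurable function `ℝⁿ → ℝ`, defined on all valuations. -/
structure BorelExpr (n : ℕ) where
  eval : (Fin n → ℝ) → ℝ
  measurable_eval : Measurable eval

/-- Predicates: finite Boolean combinations of atomic predicates `E₁ ≤ E₂`. -/
inductive Predicate (n : ℕ) where
  | le (E₁ E₂ : BorelExpr n) : Predicate n
  | and (Φ Ψ : Predicate n) : Predicate n
  | or (Φ Ψ : Predicate n) : Predicate n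
  | not (Φ : Predicate n) : Predicate n

/-- `Φ.Sat x` is the satisfaction relation `x ⊨ Φ`. -/
def Predicate.Sat {n : ℕ} : Predicate n → (Fin n → ℝ) → Prop
  | .le E₁ E₂, x => E₁.eval x ≤ E₂.eval x
  | .and Φ Ψ, x => Φ.Sat x ∧ Ψ.Sat x
  | .or Φ Ψ, x => Φ.Sat x ∨ Ψ.Sat x
  | .not Φ, x => ¬ Φ.Sat x

theorem Predicate.measurableSet_sat {n : ℕ} (Φ : Predicate n) : MeasurableSet {x | Φ.Sat x} := by
  induction Φ with
  | le E₁ E₂ => exact measurableSet_le E₁.measurable_eval E₂.measurable_eval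
  | and Φ Ψ h₁ h₂ => exact h₁.inter h₂
  | or Φ Ψ h₁ h₂ => exact h₁.union h₂
  | not Φ h => exact h.compl

/-- Update elements: no update `⊥`, a deterministic assignment, or sampling from a probability
distribution on `ℝ`. -/
inductive UpdateElt (n : ℕ) where
  | bot : UpdateElt n
  | assign (u : BorelExpr n) : UpdateElt n
  | sample (δ : ProbabilityMeasure ℝ) : UpdateElt n

/-- The law of the successor valuation `Next(τ, x)` of a transition `τ` with update `(j, u)`. -/
noncomputable def UpdateElt.law {n : ℕ} (j : Fin n) (u : UpdateElt n) (x : Fin n → ℝ) :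
    Measure (Fin n → ℝ) :=
  match u with
  | .bot => Measure.dirac x
  | .assign u => Measure.dirac (Function.update x j (u.eval x))
  | .sample δ => (δ : Measure ℝ).map (fun v => Function.update x j v)

/-- The valuation `y` can be obtained by applying the update `(j, u)` to the valuation `x`
(a sampled value is a point of the support of the distribution). -/
def UpdateElt.CanYield {n : ℕ} (j : Fin n) (u : UpdateElt n) (x y : Fin n → ℝ) : Prop :=
  match u with
  | .bot => y = x
  | .assign u => y = Function.update x j (u.eval x)
  | .sample δ => ∃ v ∈ (δ : Measure ℝ).support, y = Function.update x j v

theorem UpdateElt.measurable_update {n : ℕ} (j : Fin n) :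
    Measurable fun p : (Fin n → ℝ) × ℝ => Function.update p.1 j p.2 := by
  refine measurable_pi_iff.2 fun i => ?_
  by_cases h : i = j
  · subst h
    simpa using measurable_snd
  · simp only [Function.update_of_ne h]
    exact (measurable_pi_apply i).comp measurable_fst

instance UpdateElt.isProbabilityMeasure_law {n : ℕ} (j : Fin n) (u : UpdateElt n)
    (x : Fin n → ℝ) : IsProbabilityMeasure (u.law j x) := by
  cases u with
  | bot => exact Measure.dirac.isProbabilityMeasure
  | assign u => exact Measure.dirac.isProbabilityMeasure
  | sample δ =>
    exact Measure.isProbabilityMeasure_map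
      ((UpdateElt.measurable_update j).comp measurable_prodMk_left).aemeasurable

theorem UpdateElt.measurable_law {n : ℕ} (j : Fin n) (u : UpdateElt n) :
    Measurable (u.law j) := by
  cases u with
  | bot => exact Measure.measurable_dirac
  | assign u =>
    exact Measure.measurable_dirac.comp
      ((UpdateElt.measurable_update j).comp (measurable_id.prodMk u.measurable_eval))
  | sample δ =>
    have h : (UpdateElt.sample δ).law j = fun x : Fin n → ℝ =>
        (((δ : Measure ℝ).map (Prod.mk x))).map
          (fun p : (Fin n → ℝ) × ℝ => Function.update p.1 j p.2) := by
      funext x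
      rw [Measure.map_map (UpdateElt.measurable_update j) measurable_prodMk_left]
      rfl
    rw [h]
    exact (Measure.measurable_map _ (UpdateElt.measurable_update j)).comp
      Measurable.map_prodMk_left

/-! ## Probabilistic control-flow graphs -/

/-- A probabilistic control-flow graph with finite location set `L`, program variables
`x₁, …, xₙ`, and output variables `x₁, …, xₘ`. -/
structure PCFG (L : Type*) (n m : ℕ) where
  /-- the output variables are the first `m` program variables -/
  out_le : m ≤ n
  /-- initial location -/
  locInit : L
  /-- initial valuation -/
  valInit : Fin n → ℝ
  /-- terminal location -/
  locOut : L
  /-- the finite set of transitions `(ℓ, Pr)` -/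
  transitions : Finset (L × PMF L)
  /-- guards -/
  guard : transitions → Predicate n
  /-- updates: target variable index and update element -/
  up : transitions → Fin n × UpdateElt n
  /-- at every location the guards of the outgoing transitions cover all valuations -/
  guard_total : ∀ (ℓ : L) (x : Fin n → ℝ), ∃ τ : transitions, τ.1.1 = ℓ ∧ (guard τ).Sat x
  /-- guards of distinct transitions with the same source are mutually exclusive -/
  guard_exclusive : ∀ τ₁ τ₂ : transitions, τ₁.1.1 = τ₂.1.1 → τ₁ ≠ τ₂ →
    ∀ x : Fin n → ℝ, ¬ ((guard τ₁).Sat x ∧ (guard τ₂).Sat x)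
  /-- the terminal location has exactly one outgoing transition, a self-loop with guard `true`
  and no update -/
  locOut_loop : ∃ τ : transitions, (∀ τ' : transitions, τ'.1.1 = locOut ↔ τ' = τ) ∧
    τ.1.2 locOut = 1 ∧ (∀ x : Fin n → ℝ, (guard τ).Sat x) ∧ (up τ).2 = UpdateElt.bot

/-- A state function assigns to every location a Borel-measurable function of the valuation. -/
abbrev StateFunction (L : Type*) (n : ℕ) := L → BorelExpr n

/-- A predicate function assigns to every location a predicate over the program variables. -/
abbrev PredicateFunction (L : Type*) (n : ℕ) := L → Predicate n

namespace PCFG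

/-- States `(ℓ, x)`. -/
abbrev State (L : Type*) (n : ℕ) := L × (Fin n → ℝ)

/-- The initial state. -/
def init {L : Type*} {n m : ℕ} (C : PCFG L n m) : State L n := (C.locInit, C.valInit)

/-- The projection `x ↦ x^out` of a valuation to the output variables. -/
def proj {L : Type*} {n m : ℕ} (C : PCFG L n m) (x : Fin n → ℝ) : Fin m → ℝ :=
  fun i => x (Fin.castLE C.out_le i)

/-- The transition `τ` is enabled at the state `s`. -/
def Enabled {L : Type*} {n m : ℕ} (C : PCFG L n m) (τ : C.transitions) (s : State L n) : Prop :=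
  τ.1.1 = s.1 ∧ (C.guard τ).Sat s.2

/-- The law of `Next(τ, x)`. -/
noncomputable def nextLaw {L : Type*} {n m : ℕ} (C : PCFG L n m) (τ : C.transitions)
    (x : Fin n → ℝ) : Measure (Fin n → ℝ) :=
  (C.up τ).2.law (C.up τ).1 x

/-- The state `s'` is a successor of the state `s`. -/
def Succ {L : Type*} {n m : ℕ} (C : PCFG L n m) (s s' : State L n) : Prop :=
  ∃ τ : C.transitions, C.Enabled τ s ∧ 0 < τ.1.2 s'.1 ∧
    (C.up τ).2.CanYield (C.up τ).1 s.2 s'.2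

/-- A state is reachable if some finite path from the initial state ends in it. -/
def Reachable {L : Type*} {n m : ℕ} (C : PCFG L n m) (s : State L n) : Prop :=
  Relation.ReflTransGen C.Succ C.init s

/-- Runs: infinite sequences of states all of whose finite prefixes are finite paths. -/
def IsRun {L : Type*} {n m : ℕ} (C : PCFG L n m) (ρ : ℕ → State L n) : Prop :=
  ρ 0 = C.init ∧ ∀ i, C.Succ (ρ i) (ρ (i + 1))

/-! ### Semantics -/

theorem existsUnique_enabled {L : Type*} {n m : ℕ} (C : PCFG L n m) (s : State L n) :
    ∃! τ : C.transitions, C.Enabled τ s := by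
  obtain ⟨τ, h₁, h₂⟩ := C.guard_total s.1 s.2
  refine ⟨τ, ⟨h₁, h₂⟩, fun τ' h' => ?_⟩
  by_contra hne
  exact C.guard_exclusive τ' τ (h'.1.trans h₁.symm) hne s.2 ⟨h'.2, h₂⟩

/-- The unique transition enabled at a state. -/
noncomputable def enabledTransition {L : Type*} {n m : ℕ} (C : PCFG L n m) (s : State L n) :
    C.transitions :=
  (C.existsUnique_enabled s).choose

theorem enabledTransition_eq_iff {L : Type*} {n m : ℕ} (C : PCFG L n m) (s : State L n)
    (τ : C.transitions) : C.enabledTransition s = τ ↔ C.Enabled τ s := by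
  have h := (C.existsUnique_enabled s).choose_spec
  exact ⟨fun e => e ▸ h.1, fun e => (h.2 τ e).symm⟩

/-- The one-step law from the state `s`: with `τ = (ℓ, Pr)` the transition enabled at `s`, the
successor location is sampled from `Pr` and, independently, the successor valuation from the law of
`Next(τ, x)`. -/
noncomputable def stepLaw {L : Type*} [MeasurableSpace L] {n m : ℕ} (C : PCFG L n m)
    (s : State L n) : Measure (State L n) :=
  (C.enabledTransition s).1.2.toMeasure.prod (C.nextLaw (C.enabledTransition s) s.2)

theorem measurable_prod_nextLaw {L : Type*} [MeasurableSpace L] {n m : ℕ} (C : PCFG L n m)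
    (τ : C.transitions) :
    Measurable fun x : Fin n → ℝ => τ.1.2.toMeasure.prod (C.nextLaw τ x) := by
  obtain ⟨κ, hκ⟩ : ∃ κ : Kernel (Fin n → ℝ) (Fin n → ℝ), ∀ x, κ x = C.nextLaw τ x :=
    ⟨⟨C.nextLaw τ, UpdateElt.measurable_law _ _⟩, fun _ => rfl⟩
  have : IsMarkovKernel κ := ⟨fun x => by
    rw [hκ]
    exact UpdateElt.isProbabilityMeasure_law _ _ x⟩
  have h : (fun x : Fin n → ℝ => τ.1.2.toMeasure.prod (C.nextLaw τ x)) =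
      ⇑(Kernel.const (Fin n → ℝ) τ.1.2.toMeasure ×ₖ κ) := by
    funext x
    rw [Kernel.prod_apply, Kernel.const_apply, hκ]
  rw [h]
  exact Kernel.measurable _

theorem measurableSet_enabled {L : Type*} [MeasurableSpace L] [DiscreteMeasurableSpace L]
    {n m : ℕ} (C : PCFG L n m) (τ : C.transitions) :
    MeasurableSet {s : State L n | C.Enabled τ s} :=
  (measurable_fst (MeasurableSet.of_discrete (s := {ℓ : L | τ.1.1 = ℓ}))).inter
    (measurable_snd (C.guard τ).measurableSet_sat)

theorem measurable_stepLaw {L : Type*} [MeasurableSpace L] [DiscreteMeasurableSpace L]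
    {n m : ℕ} (C : PCFG L n m) : Measurable C.stepLaw := by
  intro B hB
  have h : C.stepLaw ⁻¹' B = ⋃ τ : C.transitions, {s : State L n | C.Enabled τ s} ∩
      Prod.snd ⁻¹' ((fun x => τ.1.2.toMeasure.prod (C.nextLaw τ x)) ⁻¹' B) := by
    ext s
    simp only [Set.mem_preimage, Set.mem_iUnion, Set.mem_inter_iff, Set.mem_ofPred_eq,
      ← enabledTransition_eq_iff]
    exact ⟨fun hs => ⟨_, rfl, hs⟩, fun ⟨τ, e, hs⟩ => by subst e; exact hs⟩
  rw [h]
  exact MeasurableSet.iUnion fun τ =>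
    (C.measurableSet_enabled τ).inter (measurable_snd (C.measurable_prod_nextLaw τ hB))

/-- The transition kernel of the Markov process of a pCFG. -/
noncomputable def stepKernel {L : Type*} [Fintype L] [MeasurableSpace L]
    [DiscreteMeasurableSpace L] {n m : ℕ} (C : PCFG L n m) : Kernel (State L n) (State L n) :=
  ⟨C.stepLaw, C.measurable_stepLaw⟩

instance isMarkovKernel_stepKernel {L : Type*} [Fintype L] [MeasurableSpace L]
    [DiscreteMeasurableSpace L] {n m : ℕ} (C : PCFG L n m) : IsMarkovKernel C.stepKernel := by
  refine ⟨fun s => ?_⟩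
  have : IsProbabilityMeasure (C.nextLaw (C.enabledTransition s) s.2) :=
    UpdateElt.isProbabilityMeasure_law _ _ _
  exact inferInstanceAs (IsProbabilityMeasure
    ((C.enabledTransition s).1.2.toMeasure.prod (C.nextLaw (C.enabledTransition s) s.2)))

/-- The step kernel as a function of the history up to time `k` (only the last state matters). -/
noncomputable def historyKernel {L : Type*} [Fintype L] [MeasurableSpace L]
    [DiscreteMeasurableSpace L] {n m : ℕ} (C : PCFG L n m) (k : ℕ) :
    Kernel (Π _ : Finset.Iic k, State L n) (State L n) :=
  C.stepKernel.comap (fun h => h ⟨k, Finset.mem_Iic.2 le_rfl⟩) (measurable_pi_apply _)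

instance isMarkovKernel_historyKernel {L : Type*} [Fintype L] [MeasurableSpace L]
    [DiscreteMeasurableSpace L] {n m : ℕ} (C : PCFG L n m) (k : ℕ) :
    IsMarkovKernel (C.historyKernel k) := by
  unfold historyKernel
  infer_instance

/-- The law of the Markov process of `C` started in the initial state, as a probability measure on
the space of all state sequences (it is carried by the runs), by the Ionescu-Tulcea theorem. -/
noncomputable def runMeasure {L : Type*} [Fintype L] [MeasurableSpace L]
    [DiscreteMeasurableSpace L] {n m : ℕ} (C : PCFG L n m) : Measure (ℕ → State L n) :=
  Kernel.traj (X := fun _ => State L n) C.historyKernel 0 (fun _ => C.init)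

instance isProbabilityMeasure_runMeasure {L : Type*} [Fintype L] [MeasurableSpace L]
    [DiscreteMeasurableSpace L] {n m : ℕ} (C : PCFG L n m) :
    IsProbabilityMeasure C.runMeasure := by
  unfold runMeasure
  infer_instance

/-- The termination time: the first time the terminal location is visited, `⊤` if there is none. -/
noncomputable def timeTerm {L : Type*} {n m : ℕ} (C : PCFG L n m) (ρ : ℕ → State L n) : ℕ∞ :=
  ⨅ (i : ℕ) (_ : (ρ i).1 = C.locOut), (i : ℕ∞)

/-- Almost-sure termination. -/
def AlmostSurelyTerminating {L : Type*} [Fintype L] [MeasurableSpace L]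
    [DiscreteMeasurableSpace L] {n m : ℕ} (C : PCFG L n m) : Prop :=
  C.runMeasure {ρ | ∃ i, (ρ i).1 = C.locOut} = 1

/-- The output of a terminating run: the projected valuation at the termination time (which does
not change afterwards). On non-terminating sequences the value is irrelevant. -/
noncomputable def output {L : Type*} {n m : ℕ} (C : PCFG L n m) (ρ : ℕ → State L n) : Fin m → ℝ :=
  C.proj (ρ (C.timeTerm ρ).toNat).2

theorem measurable_timeTerm {L : Type*} [Fintype L] [MeasurableSpace L]
    [DiscreteMeasurableSpace L] {n m : ℕ} (C : PCFG L n m) : Measurable C.timeTerm := by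
  have hle : ∀ k : ℕ, MeasurableSet {ρ : ℕ → State L n | (ρ k).1 = C.locOut} := fun k =>
    (measurable_fst.comp (measurable_pi_apply k)) (MeasurableSet.of_discrete (s := {C.locOut}))
  have hle' : ∀ k : ℕ, MeasurableSet {ρ : ℕ → State L n | (k : ℕ∞) ≤ C.timeTerm ρ} := by
    intro k
    have : {ρ : ℕ → State L n | (k : ℕ∞) ≤ C.timeTerm ρ} =
        ⋂ i : ℕ, ⋂ _ : i < k, {ρ | (ρ i).1 = C.locOut}ᶜ := by
      ext ρ
      simp only [timeTerm, Set.mem_ofPred_eq, le_iInf_iff, Nat.cast_le, Set.mem_iInter,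
        Set.mem_compl_iff]
      exact ⟨fun h i hi e => absurd (h i e) (not_le.2 hi),
        fun h i e => not_lt.1 fun hi => h i hi e⟩
    rw [this]
    exact MeasurableSet.iInter fun i => MeasurableSet.iInter fun _ => (hle i).compl
  refine measurable_to_countable' fun y => ?_
  induction y using ENat.recTopCoe with
  | top =>
    have : C.timeTerm ⁻¹' {⊤} = ⋂ k : ℕ, {ρ | (k : ℕ∞) ≤ C.timeTerm ρ} := by
      ext ρ
      simp only [Set.mem_preimage, Set.mem_singleton_iff, Set.mem_iInter, Set.mem_ofPred_eq]
      exact ⟨fun h k => h ▸ le_top, fun h => ENat.eq_top_iff_forall_ge.2 h⟩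
    rw [this]
    exact MeasurableSet.iInter hle'
  | coe k =>
    have : C.timeTerm ⁻¹' {(k : ℕ∞)} = {ρ | (k : ℕ∞) ≤ C.timeTerm ρ} \
        {ρ | ((k + 1 : ℕ) : ℕ∞) ≤ C.timeTerm ρ} := by
      ext ρ
      simp only [Set.mem_preimage, Set.mem_singleton_iff, Set.mem_sdiff, Set.mem_ofPred_eq,
        Nat.cast_add, Nat.cast_one, ENat.add_one_le_iff (ENat.natCast_ne_top k), not_lt]
      exact ⟨fun h => ⟨h.ge, h.le⟩, fun h => le_antisymm h.2 h.1⟩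
    rw [this]
    exact (hle' k).diff (hle' (k + 1))

theorem measurable_output {L : Type*} [Fintype L] [MeasurableSpace L]
    [DiscreteMeasurableSpace L] {n m : ℕ} (C : PCFG L n m) : Measurable C.output := by
  have h₁ : Measurable fun ρ : ℕ → State L n => (C.timeTerm ρ).toNat :=
    (Measurable.of_discrete (f := ENat.toNat)).comp C.measurable_timeTerm
  have h₂ : Measurable fun p : ℕ × (ℕ → State L n) => p.2 p.1 :=
    measurable_from_prod_countable_right fun k => measurable_pi_apply k
  have h₃ : Measurable C.proj := measurable_pi_iff.2 fun i => measurable_pi_apply _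
  exact h₃.comp (measurable_snd.comp (h₂.comp (h₁.prodMk measurable_id)))

/-- The output distribution (of an almost-surely terminating pCFG): the probability of a Borel set
`B` is the probability that the output lies in `B`. -/
noncomputable def outputDist {L : Type*} [Fintype L] [MeasurableSpace L]
    [DiscreteMeasurableSpace L] {n m : ℕ} (C : PCFG L n m) : Measure (Fin m → ℝ) :=
  C.runMeasure.map C.output

/-! ### Invariants, expectation supermartingales and submartingales -/

/-- A predicate function is an invariant if it contains all reachable states. -/
def IsInvariant {L : Type*} {n m : ℕ} (C : PCFG L n m) (I : PredicateFunction L n) : Prop :=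
  ∀ s : State L n, C.Reachable s → (I s.1).Sat s.2

/-- Upper expectation supermartingales for `f` with respect to `I`. The expectations in
`∑ ℓ', Pr ℓ' * E[U(ℓ', N) + f(N^out)]` are taken in `[-∞, ∞]`, and locations with `Pr ℓ' = 0`
contribute `0`; so the inequality `U(ℓ, x) ≥ ∑ … - f(x^out)` says that no positive part has infinite
expectation and that, when the sum is not `-∞`, the inequality holds between real numbers. -/
structure IsUESM {L : Type*} [Fintype L] {n m : ℕ} (C : PCFG L n m) (I : PredicateFunction L n)
    (f : (Fin m → ℝ) → ℝ) (U : StateFunction L n) : Prop where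
  zero_on_output : ∀ x, (I C.locOut).Sat x → (U C.locOut).eval x = 0
  expected_lt_top : ∀ (τ : C.transitions) (x : Fin n → ℝ),
    (I τ.1.1).Sat x → (C.guard τ).Sat x → ∀ ℓ', τ.1.2 ℓ' ≠ 0 →
      ∫⁻ y, ENNReal.ofReal ((U ℓ').eval y + f (C.proj y)) ∂(C.nextLaw τ x) < ⊤
  expected_decrease : ∀ (τ : C.transitions) (x : Fin n → ℝ),
    (I τ.1.1).Sat x → (C.guard τ).Sat x →
    (∀ ℓ', τ.1.2 ℓ' ≠ 0 →
      Integrable (fun y => (U ℓ').eval y + f (C.proj y)) (C.nextLaw τ x)) →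
    (U τ.1.1).eval x ≥
      (∑ ℓ', (τ.1.2 ℓ').toReal * ∫ y, ((U ℓ').eval y + f (C.proj y)) ∂(C.nextLaw τ x))
        - f (C.proj x)

/-- Lower expectation submartingales for `f` with respect to `I`; dual to `IsUESM`. -/
structure IsLESM {L : Type*} [Fintype L] {n m : ℕ} (C : PCFG L n m) (I : PredicateFunction L n)
    (f : (Fin m → ℝ) → ℝ) (Λ : StateFunction L n) : Prop where
  zero_on_output : ∀ x, (I C.locOut).Sat x → (Λ C.locOut).eval x = 0
  bot_lt_expected : ∀ (τ : C.transitions) (x : Fin n → ℝ),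
    (I τ.1.1).Sat x → (C.guard τ).Sat x → ∀ ℓ', τ.1.2 ℓ' ≠ 0 →
      ∫⁻ y, ENNReal.ofReal (-((Λ ℓ').eval y + f (C.proj y))) ∂(C.nextLaw τ x) < ⊤
  expected_increase : ∀ (τ : C.transitions) (x : Fin n → ℝ),
    (I τ.1.1).Sat x → (C.guard τ).Sat x →
    (∀ ℓ', τ.1.2 ℓ' ≠ 0 →
      Integrable (fun y => (Λ ℓ').eval y + f (C.proj y)) (C.nextLaw τ x)) →
    (Λ τ.1.1).eval x ≤
      (∑ ℓ', (τ.1.2 ℓ').toReal * ∫ y, ((Λ ℓ').eval y + f (C.proj y)) ∂(C.nextLaw τ x))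
        - f (C.proj x)

/-! ### OST-soundness -/

/-- The process `Y_i = η(Z_i) + f(X_i^out)`, where `Z_i = (ℓ_i, X_i)` is the `i`-th state. -/
def process {L : Type*} {n m : ℕ} (C : PCFG L n m) (η : StateFunction L n)
    (f : (Fin m → ℝ) → ℝ) (i : ℕ) (ρ : ℕ → State L n) : ℝ :=
  (η (ρ i).1).eval (ρ i).2 + f (C.proj (ρ i).2)

/-- (C1): the termination time is almost surely bounded. -/
def OSTC1 {L : Type*} [Fintype L] [MeasurableSpace L] [DiscreteMeasurableSpace L] {n m : ℕ}
    (C : PCFG L n m) : Prop :=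
  ∃ c : ℕ, ∀ᵐ ρ ∂C.runMeasure, C.timeTerm ρ ≤ c

/-- (C2): `Y` is uniformly bounded on all runs up to termination. -/
def OSTC2 {L : Type*} {n m : ℕ} (C : PCFG L n m) (η : StateFunction L n)
    (f : (Fin m → ℝ) → ℝ) : Prop :=
  ∃ c : ℝ, ∀ (t : ℕ) (ρ : ℕ → State L n), C.IsRun ρ →
    |C.process η f (min (t : ℕ∞) (C.timeTerm ρ)).toNat ρ| ≤ c

/-- (C3): finite expected termination time and uniformly bounded conditional expected one-step
change, given the first `t` steps (the `σ`-algebra generated by the states `Z_0, …, Z_t`). -/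
def OSTC3 {L : Type*} [Fintype L] [MeasurableSpace L] [DiscreteMeasurableSpace L] {n m : ℕ}
    (C : PCFG L n m) (η : StateFunction L n) (f : (Fin m → ℝ) → ℝ) : Prop :=
  ∫⁻ ρ, (C.timeTerm ρ : ℝ≥0∞) ∂C.runMeasure < ⊤ ∧
  Integrable (C.process η f 0) C.runMeasure ∧
  ∃ c : ℝ, ∀ t : ℕ,
    C.runMeasure[fun ρ => |C.process η f (t + 1) ρ - C.process η f t ρ| |
      Filtration.piLE (X := fun _ : ℕ => State L n) t] ≤ᵐ[C.runMeasure] fun _ => c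

/-- (C4): exponentially decreasing tails of the termination time and polynomially bounded one-step
change. -/
def OSTC4 {L : Type*} [Fintype L] [MeasurableSpace L] [DiscreteMeasurableSpace L] {n m : ℕ}
    (C : PCFG L n m) (η : StateFunction L n) (f : (Fin m → ℝ) → ℝ) : Prop :=
  ∃ M c₁ c₂ d : ℝ, 0 < c₂ ∧
    (∀ᶠ k : ℕ in atTop,
      C.runMeasure.real {ρ | (k : ℕ∞) < C.timeTerm ρ} ≤ c₁ * Real.exp (-c₂ * k)) ∧
    ∀ k : ℕ, 1 ≤ k → ∀ᵐ ρ ∂C.runMeasure,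
      |C.process η f (k + 1) ρ - C.process η f k ρ| ≤ M * (k : ℝ) ^ d

/-- OST-soundness of `(C, η, f)`. -/
def OSTSound {L : Type*} [Fintype L] [MeasurableSpace L] [DiscreteMeasurableSpace L] {n m : ℕ}
    (C : PCFG L n m) (η : StateFunction L n) (f : (Fin m → ℝ) → ℝ) : Prop :=
  (∀ i, Integrable (C.process η f i) C.runMeasure) ∧
    (C.OSTC1 ∨ C.OSTC2 η f ∨ C.OSTC3 η f ∨ C.OSTC4 η f)

end PCFG

/-! Write `Y_t` for the process and `T` for the termination time. Optional stopping reduces here to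
a convergence statement for the sequence `E[Y_t]`.

The terminal location is absorbing, so almost every trajectory is constant from time `T` on. There
the state function vanishes, by the invariant, and `Y_t` equals `f` of the output. Stopping the
process therefore changes nothing, and by almost-sure termination `Y_t` is eventually equal to
`f(output)`.

The Markov property integrates the one-step inequality into monotonicity: `E[Y_t]` decreases for a
UESM and increases for an LESM (`IsUESM.antitone_integral_process`,
`IsLESM.monotone_integral_process`). Its value at `t = 0` is the bound in the theorem, so it remains
to show `E[Y_t] → E[f(output)]`.

This is dominated convergence (`OSTSound.tendsto_integral_process`). Under (C2) a constant
dominates. Under (C1), (C3) and (C4) the increments have summable `L¹` norms, since `Y_{t+1} - Y_t`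
vanishes almost surely off `{T > t}` and each condition controls the integral over that event; then
`|Y_0| + ∑ |Y_{i+1} - Y_i|` dominates. -/

/-- A sequence of integrable functions whose increments have summable `L¹` norms, and which is
almost everywhere eventually equal to `g`, converges to `g` in mean. -/
theorem tendsto_integral_of_summable_increments {Ω : Type*} [MeasurableSpace Ω] {P : Measure Ω}
    {Y : ℕ → Ω → ℝ} {g : Ω → ℝ} (hY : ∀ i, Integrable (Y i) P)
    (hg : AEStronglyMeasurable g P)
    (hsum : Summable fun i => ∫ ω, |Y (i + 1) ω - Y i ω| ∂P)
    (hlim : ∀ᵐ ω ∂P, ∃ i, ∀ j, i ≤ j → Y j ω = g ω) :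
    Integrable g P ∧ Tendsto (fun i => ∫ ω, Y i ω ∂P) atTop (nhds (∫ ω, g ω ∂P)) := by
  have hD : ∀ i, Integrable (fun ω => Y (i + 1) ω - Y i ω) P := fun i => (hY _).sub (hY i)
  -- The dominating function: telescoping and the triangle inequality give `|Y n| ≤ G` for every
  -- `n`, and Tonelli makes `G` integrable.
  set G : Ω → ℝ≥0∞ := fun ω => ‖Y 0 ω‖ₑ + ∑' i, ‖Y (i + 1) ω - Y i ω‖ₑ with hG
  have hGm : AEMeasurable G P :=
    (hY 0).1.enorm.add (AEMeasurable.tsum fun i => (hD i).1.enorm)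
  have hGi : ∫⁻ ω, G ω ∂P ≠ ⊤ := by
    rw [hG, lintegral_add_left' (hY 0).1.enorm, lintegral_tsum fun i => (hD i).1.enorm]
    refine ENNReal.add_ne_top.2 ⟨(hY 0).2.ne, ?_⟩
    have h : ∀ i, ∫⁻ ω, ‖Y (i + 1) ω - Y i ω‖ₑ ∂P =
        ENNReal.ofReal (∫ ω, |Y (i + 1) ω - Y i ω| ∂P) := fun i =>
      (ofReal_integral_norm_eq_lintegral_enorm (hD i)).symm
    simp only [h]
    exact hsum.tsum_ofReal_ne_top
  have hle : ∀ n ω, ‖Y n ω‖ₑ ≤ G ω := by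
    intro n ω
    have h : ‖Y n ω‖ₑ ≤ ‖Y 0 ω‖ₑ + ∑ i ∈ Finset.range n, ‖Y (i + 1) ω - Y i ω‖ₑ := by
      induction n with
      | zero => simp
      | succ n ih =>
        rw [Finset.sum_range_succ, ← add_assoc]
        calc ‖Y (n + 1) ω‖ₑ = ‖Y n ω + (Y (n + 1) ω - Y n ω)‖ₑ := by congr 1; ring
          _ ≤ ‖Y n ω‖ₑ + ‖Y (n + 1) ω - Y n ω‖ₑ := enorm_add_le _ _
          _ ≤ _ := by gcongr
    exact h.trans (by simp only [hG]; gcongr; exact ENNReal.sum_le_tsum _)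
  have hbd : ∀ᵐ ω ∂P, ∀ n, ‖Y n ω‖ ≤ (G ω).toReal := by
    filter_upwards [ae_lt_top' hGm hGi] with ω hω n
    rw [← toReal_enorm]
    exact ENNReal.toReal_mono hω.ne (hle n ω)
  have hGint : Integrable (fun ω => (G ω).toReal) P := integrable_toReal_of_lintegral_ne_top hGm hGi
  refine ⟨hGint.mono' hg ?_, tendsto_integral_of_dominated_convergence _ (fun n => (hY n).1) hGint
    (fun n => hbd.mono fun ω h => h n) ?_⟩
  · filter_upwards [hbd, hlim] with ω h₁ ⟨i, hi⟩
    rw [← hi i le_rfl]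
    exact h₁ i
  · filter_upwards [hlim] with ω ⟨i, hi⟩
    exact tendsto_const_nhds.congr' (eventually_atTop.2 ⟨i, fun j hj => (hi j hj).symm⟩)

namespace PCFG

/-! ### Absorption at the terminal location. -/

section Paths

variable {L : Type*} {n m : ℕ} {C : PCFG L n m}

theorem IsRun.reachable {ρ : ℕ → State L n} (hρ : C.IsRun ρ) (i : ℕ) : C.Reachable (ρ i) := by
  induction i with
  | zero => rw [hρ.1]; exact .refl
  | succ i ih => exact ih.tail (hρ.2 i)

theorem Succ.eq_of_locOut {s s' : State L n} (h : C.Succ s s') (hs : s.1 = C.locOut) : s' = s := by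
  obtain ⟨τ, hτ, hone, -, hbot⟩ := C.locOut_loop
  obtain ⟨τ', hen, hpos, hy⟩ := h
  obtain rfl : τ' = τ := (hτ τ').1 (hen.1.trans hs)
  rw [hbot] at hy
  rw [PMF.apply_eq_one_iff] at hone
  have hloc : s'.1 ∈ τ'.1.2.support := (PMF.mem_support_iff _ _).2 hpos.ne'
  rw [hone] at hloc
  exact Prod.ext (hloc.trans hs.symm) hy

theorem IsRun.eq_of_le {ρ : ℕ → State L n} (hρ : C.IsRun ρ) {i j : ℕ} (hi : (ρ i).1 = C.locOut)
    (hij : i ≤ j) : ρ j = ρ i := by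
  induction j, hij using Nat.le_induction with
  | base => rfl
  | succ j _ ih => exact ((hρ.2 j).eq_of_locOut (ih ▸ hi)).trans ih

theorem timeTerm_le_of_locOut {ρ : ℕ → State L n} {i : ℕ} (hi : (ρ i).1 = C.locOut) :
    C.timeTerm ρ ≤ i := iInf₂_le i hi

theorem exists_timeTerm_eq {ρ : ℕ → State L n} (h : C.timeTerm ρ ≠ ⊤) :
    ∃ k : ℕ, C.timeTerm ρ = k ∧ (ρ k).1 = C.locOut := by
  obtain ⟨k, hk⟩ := ENat.ne_top_iff_exists.1 h
  refine ⟨k, hk.symm, ?_⟩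
  have hlt : C.timeTerm ρ < ((k + 1 : ℕ) : ℕ∞) := by
    rw [← hk]; exact_mod_cast Nat.lt_succ_self k
  simp only [timeTerm, iInf_lt_iff] at hlt
  obtain ⟨i, hi, hik⟩ := hlt
  have h₁ : i ≤ k := Nat.lt_succ_iff.1 (by exact_mod_cast hik)
  have h₂ : k ≤ i := by
    have := timeTerm_le_of_locOut hi
    rw [← hk] at this
    exact_mod_cast this
  rwa [le_antisymm h₂ h₁]

theorem lt_timeTerm_iff {ρ : ℕ → State L n} {t : ℕ} :
    (t : ℕ∞) < C.timeTerm ρ ↔ ∀ i ≤ t, (ρ i).1 ≠ C.locOut := by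
  constructor
  · intro h i hit hi
    exact (h.trans_le (timeTerm_le_of_locOut hi)).not_ge (by exact_mod_cast hit)
  · intro h
    by_contra! hle
    obtain ⟨k, hk, hloc⟩ := exists_timeTerm_eq (ne_top_of_le_ne_top (ENat.natCast_ne_top t) hle)
    exact h k (by rw [hk] at hle; exact_mod_cast hle) hloc

theorem IsRun.eq_at_timeTerm {ρ : ℕ → State L n} (hρ : C.IsRun ρ) {t : ℕ}
    (ht : C.timeTerm ρ ≤ t) : ρ t = ρ (C.timeTerm ρ).toNat := by
  obtain ⟨k, hk, hloc⟩ := exists_timeTerm_eq (ne_top_of_le_ne_top (ENat.natCast_ne_top t) ht)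
  rw [hk] at ht ⊢
  exact hρ.eq_of_le hloc (by exact_mod_cast ht)

theorem IsRun.loc_eq_locOut {ρ : ℕ → State L n} (hρ : C.IsRun ρ) {t : ℕ}
    (ht : C.timeTerm ρ ≤ t) : (ρ t).1 = C.locOut := by
  obtain ⟨k, hk, hloc⟩ := exists_timeTerm_eq (ne_top_of_le_ne_top (ENat.natCast_ne_top t) ht)
  rw [hk] at ht
  rw [hρ.eq_of_le hloc (by exact_mod_cast ht), hloc]

/-- Absorption makes the stopped process equal to the unstopped one on runs, so the bound in (C2)
bounds `Y_t` itself. -/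
theorem IsRun.process_min_timeTerm {ρ : ℕ → State L n} (hρ : C.IsRun ρ) (η : StateFunction L n)
    (f : (Fin m → ℝ) → ℝ) (t : ℕ) :
    C.process η f (min (t : ℕ∞) (C.timeTerm ρ)).toNat ρ = C.process η f t ρ := by
  rcases le_total (t : ℕ∞) (C.timeTerm ρ) with h | h
  · rw [min_eq_left h]; rfl
  · rw [min_eq_right h, process, process, hρ.eq_at_timeTerm h]

/-- States of a run are reachable, hence satisfy the invariant; this is what makes the zero
condition at the terminal location applicable. -/
theorem IsRun.process_eq_output {ρ : ℕ → State L n} (hρ : C.IsRun ρ) {I : PredicateFunction L n}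
    (hI : C.IsInvariant I) {η : StateFunction L n}
    (hη : ∀ x, (I C.locOut).Sat x → (η C.locOut).eval x = 0) (f : (Fin m → ℝ) → ℝ) {t : ℕ}
    (ht : C.timeTerm ρ ≤ t) : C.process η f t ρ = f (C.output ρ) := by
  have hsat := hI _ (hρ.reachable t)
  rw [hρ.loc_eq_locOut ht] at hsat
  rw [process, hρ.loc_eq_locOut ht, hη _ hsat, zero_add, output, hρ.eq_at_timeTerm ht]

end Paths

/-! ### The one-step kernel: almost-sure successors and finite-sum integrals. -/

section OneStep

theorem _root_.UpdateElt.measurableSet_canYield {n : ℕ} (j : Fin n) (u : UpdateElt n) :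
    MeasurableSet {p : (Fin n → ℝ) × (Fin n → ℝ) | u.CanYield j p.1 p.2} := by
  cases u with
  | bot => exact measurableSet_eq_fun measurable_snd measurable_fst
  | assign u =>
    exact measurableSet_eq_fun measurable_snd ((UpdateElt.measurable_update j).comp
      (measurable_fst.prodMk (u.measurable_eval.comp measurable_fst)))
  | sample δ =>
    -- The sampled value can only be the `j`-th coordinate of the new valuation, which eliminates
    -- the existential quantifier and avoids projecting a measurable set.
    have h : {p : (Fin n → ℝ) × (Fin n → ℝ) | (UpdateElt.sample δ).CanYield j p.1 p.2} =
        {p | p.2 j ∈ (δ : Measure ℝ).support} ∩ {p | p.2 = Function.update p.1 j (p.2 j)} := by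
      ext p
      constructor
      · rintro ⟨v, hv, hp⟩
        have hj : p.2 j = v := by rw [hp]; simp
        exact ⟨by simpa [hj] using hv, by simpa [hj] using hp⟩
      · rintro ⟨hv, hp⟩
        exact ⟨_, hv, hp⟩
    have hj : Measurable fun p : (Fin n → ℝ) × (Fin n → ℝ) => p.2 j :=
      (measurable_pi_apply j).comp measurable_snd
    rw [h]
    exact (hj (Measure.isClosed_support).measurableSet).inter (measurableSet_eq_fun measurable_snd
      ((UpdateElt.measurable_update j).comp (measurable_fst.prodMk hj)))

theorem _root_.UpdateElt.ae_canYield {n : ℕ} (j : Fin n) (u : UpdateElt n) (x : Fin n → ℝ) :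
    ∀ᵐ y ∂u.law j x, u.CanYield j x y := by
  have hm : MeasurableSet {y | u.CanYield j x y} :=
    measurable_prodMk_left (u.measurableSet_canYield j)
  cases u with
  | bot => exact (ae_dirac_iff hm).2 rfl
  | assign u => exact (ae_dirac_iff hm).2 rfl
  | sample δ =>
    refine (ae_map_iff ((UpdateElt.measurable_update j).comp
      measurable_prodMk_left).aemeasurable hm).2 ?_
    filter_upwards [Measure.support_mem_ae (μ := (δ : Measure ℝ))] with v hv
    exact ⟨v, hv, rfl⟩

variable {L : Type*} [Fintype L] [MeasurableSpace L] [DiscreteMeasurableSpace L] {n m : ℕ}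
  (C : PCFG L n m)

instance isProbabilityMeasure_nextLaw (τ : C.transitions) (x : Fin n → ℝ) :
    IsProbabilityMeasure (C.nextLaw τ x) :=
  UpdateElt.isProbabilityMeasure_law _ _ _

theorem measurableSet_succ {L : Type*} [MeasurableSpace L] [DiscreteMeasurableSpace L] {n m : ℕ}
    (C : PCFG L n m) :
    MeasurableSet {p : State L n × State L n | C.Succ p.1 p.2} := by
  have h : {p : State L n × State L n | C.Succ p.1 p.2} = ⋃ τ : C.transitions,
      {p | C.Enabled τ p.1} ∩ ({p | 0 < τ.1.2 p.2.1} ∩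
        {p | (C.up τ).2.CanYield (C.up τ).1 p.1.2 p.2.2}) := by
    ext p
    simp [Succ]
  rw [h]
  refine MeasurableSet.iUnion fun τ => (measurable_fst (C.measurableSet_enabled τ)).inter
    (.inter ?_ ?_)
  · exact (measurable_fst.comp measurable_snd)
      (MeasurableSet.of_discrete (s := {ℓ : L | 0 < τ.1.2 ℓ}))
  · exact ((measurable_snd.comp measurable_fst).prodMk (measurable_snd.comp measurable_snd))
      (UpdateElt.measurableSet_canYield _ _)

theorem stepKernel_apply (s : State L n) : C.stepKernel s =
    (C.enabledTransition s).1.2.toMeasure.prod (C.nextLaw (C.enabledTransition s) s.2) := rfl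

theorem ae_succ_stepKernel (s : State L n) : ∀ᵐ s' ∂C.stepKernel s, C.Succ s s' := by
  have h₁ : ∀ᵐ ℓ ∂(C.enabledTransition s).1.2.toMeasure, 0 < (C.enabledTransition s).1.2 ℓ := by
    rw [ae_iff, PMF.toMeasure_apply_eq_zero_iff _ .of_discrete, Set.disjoint_left]
    intro ℓ hℓ h
    exact h (pos_iff_ne_zero.2 hℓ)
  have h₂ := UpdateElt.ae_canYield (C.up (C.enabledTransition s)).1
    (C.up (C.enabledTransition s)).2 s.2
  rw [stepKernel_apply]
  filter_upwards [Measure.quasiMeasurePreserving_fst.ae h₁,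
    Measure.quasiMeasurePreserving_snd.ae h₂] with s' h₁ h₂
  exact ⟨_, (C.enabledTransition_eq_iff s _).1 rfl, h₁, h₂⟩

/-- A function that is integrable for the one-step law is integrable for the law of the next
valuation at each location of positive probability. -/
theorem integrable_nextLaw_of_stepKernel {s : State L n} {h : State L n → ℝ}
    (hint : Integrable h (C.stepKernel s)) (ℓ : L) (hℓ : (C.enabledTransition s).1.2 ℓ ≠ 0) :
    Integrable (fun y => h (ℓ, y)) (C.nextLaw (C.enabledTransition s) s.2) := by
  rw [stepKernel_apply] at hint
  -- By Fubini the locations with a non-integrable section form a null set, and a null set of a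
  -- `PMF` misses its support.
  by_contra hcon
  have := (ae_iff.1 hint.prod_right_ae)
  rw [PMF.toMeasure_apply_eq_zero_iff _ .of_discrete, Set.disjoint_left] at this
  exact this ((PMF.mem_support_iff _ _).2 hℓ) hcon

theorem integral_stepKernel {s : State L n} {h : State L n → ℝ}
    (hint : Integrable h (C.stepKernel s)) :
    ∫ s', h s' ∂C.stepKernel s = ∑ ℓ, ((C.enabledTransition s).1.2 ℓ).toReal *
      ∫ y, h (ℓ, y) ∂C.nextLaw (C.enabledTransition s) s.2 := by
  rw [stepKernel_apply] at hint ⊢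
  rw [integral_prod _ hint, PMF.integral_eq_sum]
  rfl

end OneStep

/-! ### The Markov property of the trajectory measure. -/

section Trajectories

variable {L : Type*} [Fintype L] [MeasurableSpace L] [DiscreteMeasurableSpace L] {n m : ℕ}
  (C : PCFG L n m)

/-- The Markov property: the joint law of two consecutive states. -/
theorem map_pair_runMeasure (t : ℕ) :
    C.runMeasure.map (fun ρ => (ρ t, ρ (t + 1))) =
      (C.runMeasure.map fun ρ => ρ t) ⊗ₘ C.stepKernel := by
  set g : (Π _ : Finset.Iic t, State L n) → State L n := fun h => h ⟨t, Finset.mem_Iic.2 le_rfl⟩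
  have hg : Measurable g := measurable_pi_apply _
  have hfr : Measurable (Preorder.frestrictLe (π := fun _ : ℕ => State L n) t) := by fun_prop
  -- Ionescu-Tulcea describes the joint law of the history up to `t` and the next state. Pushing
  -- forward along the last coordinate `g` suffices, because `historyKernel` sees the history only
  -- through `g`.
  have key := Kernel.partialTraj_compProd_eq_map_traj (X := fun _ => State L n)
    (κ := C.historyKernel) (Nat.zero_le t) (x₀ := fun _ => C.init)
  rw [← Kernel.traj_map_frestrictLe_apply] at key
  have h₁ : C.runMeasure.map (fun ρ => (ρ t, ρ (t + 1))) =
      (C.runMeasure.map fun ρ => (Preorder.frestrictLe t ρ, ρ (t + 1))).map (Prod.map g id) := by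
    rw [Measure.map_map (hg.prodMap measurable_id) (hfr.prodMk (measurable_pi_apply _))]
    rfl
  have h₂ : C.runMeasure.map (fun ρ => ρ t) =
      (C.runMeasure.map (Preorder.frestrictLe t)).map g := by
    rw [Measure.map_map hg hfr]
    rfl
  rw [h₁, h₂]
  unfold runMeasure
  rw [← key]
  ext s hs
  rw [Measure.map_apply (hg.prodMap measurable_id) hs,
    Measure.compProd_apply ((hg.prodMap measurable_id) hs), Measure.compProd_apply hs,
    lintegral_map (Kernel.measurable_kernel_prodMk_left hs) hg]
  rfl

theorem ae_init_runMeasure : ∀ᵐ ρ ∂C.runMeasure, ρ 0 = C.init := by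
  have h : C.runMeasure.map (Preorder.frestrictLe 0) =
      Measure.dirac (fun _ => C.init) := by
    unfold runMeasure
    rw [Kernel.traj_map_frestrictLe_apply, Kernel.partialTraj_self, Kernel.id_apply]
  have hm : MeasurableSet {x : Π _ : Finset.Iic 0, State L n |
      x ⟨0, Finset.mem_Iic.2 le_rfl⟩ = C.init} :=
    (measurable_pi_apply (X := fun _ : Finset.Iic 0 => State L n) ⟨0, Finset.mem_Iic.2 le_rfl⟩)
      (measurableSet_singleton (C.init : State L n))
  have hae : ∀ᵐ x ∂(C.runMeasure.map (Preorder.frestrictLe 0)),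
      x ⟨0, Finset.mem_Iic.2 le_rfl⟩ = C.init := by
    rw [h]
    exact (ae_dirac_iff hm).2 rfl
  exact ae_of_ae_map (by fun_prop) hae

/-- The law of the process is carried by the runs. -/
theorem ae_isRun : ∀ᵐ ρ ∂C.runMeasure, C.IsRun ρ := by
  have h : ∀ t, ∀ᵐ ρ ∂C.runMeasure, C.Succ (ρ t) (ρ (t + 1)) := by
    intro t
    have hae : ∀ᵐ p ∂(C.runMeasure.map fun ρ => (ρ t, ρ (t + 1))), C.Succ p.1 p.2 := by
      rw [map_pair_runMeasure]
      exact (Measure.ae_compProd_iff C.measurableSet_succ).2 (ae_of_all _ C.ae_succ_stepKernel)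
    have hpair : Measurable fun ρ : ℕ → State L n => (ρ t, ρ (t + 1)) := by fun_prop
    exact ae_of_ae_map (p := fun p : State L n × State L n => C.Succ p.1 p.2)
      hpair.aemeasurable hae
  filter_upwards [C.ae_init_runMeasure, ae_all_iff.2 h] with ρ h₀ h₁
  exact ⟨h₀, h₁⟩

variable {C}

/-- Fubini for the joint law of `(Z_t, Z_{t+1})`. It plays the role of the tower property without
conditional expectations, and supplies the integrability that the one-step inequalities of U/LESMs
require. -/
theorem ae_integrable_stepKernel {h : State L n → ℝ} (hm : Measurable h) {t : ℕ}
    (hint : Integrable (fun ρ => h (ρ (t + 1))) C.runMeasure) :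
    (∀ᵐ ρ ∂C.runMeasure, Integrable h (C.stepKernel (ρ t))) ∧
    Integrable (fun ρ => ∫ s, h s ∂C.stepKernel (ρ t)) C.runMeasure ∧
    ∫ ρ, h (ρ (t + 1)) ∂C.runMeasure = ∫ ρ, ∫ s, h s ∂C.stepKernel (ρ t) ∂C.runMeasure := by
  have hpair : Measurable fun ρ : ℕ → State L n => (ρ t, ρ (t + 1)) := by fun_prop
  have hev : Measurable fun ρ : ℕ → State L n => ρ t := measurable_pi_apply t
  have hm₂ : Measurable fun p : State L n × State L n => h p.2 := hm.comp measurable_snd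
  have hint' : Integrable (fun p : State L n × State L n => h p.2)
      ((C.runMeasure.map fun ρ => ρ t) ⊗ₘ C.stepKernel) := by
    rw [← map_pair_runMeasure]
    exact (integrable_map_measure hm₂.aestronglyMeasurable hpair.aemeasurable).2 hint
  have hκ : AEStronglyMeasurable (fun z => ∫ s, h s ∂C.stepKernel z)
      (C.runMeasure.map fun ρ => ρ t) :=
    hm.stronglyMeasurable.integral_kernel.aestronglyMeasurable
  obtain ⟨hi₁, hi₂⟩ := (Measure.integrable_compProd_iff hm₂.aestronglyMeasurable).1 hint'
  refine ⟨ae_of_ae_map hev.aemeasurable hi₁,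
    (hi₂.mono' hκ (ae_of_all _ fun z => norm_integral_le_integral_norm _)).comp_measurable hev, ?_⟩
  have h₁ := Measure.integral_compProd hint'
  rw [← map_pair_runMeasure, integral_map hpair.aemeasurable hm₂.aestronglyMeasurable,
    integral_map hev.aemeasurable] at h₁
  · exact h₁
  · exact hκ

end Trajectories

/-! ### Monotone expectations, summable increments, optional stopping. -/

section Soundness

variable {L : Type*} [Fintype L] [MeasurableSpace L] [DiscreteMeasurableSpace L] {n m : ℕ}
  {C : PCFG L n m}

theorem measurable_proj {L : Type*} {n m : ℕ} {C : PCFG L n m} : Measurable C.proj :=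
  measurable_pi_iff.2 fun _ => measurable_pi_apply _

theorem measurable_stateFunction_add (η : StateFunction L n) {f : (Fin m → ℝ) → ℝ}
    (hf : Measurable f) : Measurable fun s : State L n => (η s.1).eval s.2 + f (C.proj s.2) :=
  (measurable_from_prod_countable_right fun ℓ => (η ℓ).measurable_eval).add
    (hf.comp (measurable_proj.comp measurable_snd))

theorem integral_process_zero (η : StateFunction L n) (f : (Fin m → ℝ) → ℝ) :
    ∫ ρ, C.process η f 0 ρ ∂C.runMeasure =
      (η C.locInit).eval C.valInit + f (C.proj C.valInit) := by
  have h : C.process η f 0 =ᵐ[C.runMeasure] fun _ =>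
      (η C.locInit).eval C.valInit + f (C.proj C.valInit) := by
    filter_upwards [C.ae_init_runMeasure] with ρ hρ
    rw [process, hρ]
    rfl
  rw [integral_congr_ae h]
  simp

/-- Almost every trajectory is a run, so its states satisfy the invariant and the UESM inequality
applies at `Z_t`. Moving `f(x^out)` to the left, it says that `Y_t` is at least the kernel average
of `Y_{t+1}`; then integrate. -/
theorem IsUESM.antitone_integral_process {I : PredicateFunction L n} (hI : C.IsInvariant I)
    {f : (Fin m → ℝ) → ℝ} (hf : Measurable f) {U : StateFunction L n} (hU : C.IsUESM I f U)
    (hint : ∀ i, Integrable (C.process U f i) C.runMeasure) :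
    Antitone fun i => ∫ ρ, C.process U f i ρ ∂C.runMeasure := by
  refine antitone_nat_of_succ_le fun t => ?_
  obtain ⟨h₁, h₂, h₃⟩ := ae_integrable_stepKernel (measurable_stateFunction_add (C := C) U hf)
    (hint (t + 1))
  refine h₃.trans_le (integral_mono_ae h₂ (hint t) ?_)
  filter_upwards [h₁, C.ae_isRun] with ρ hρ hrun
  have hen := (C.enabledTransition_eq_iff (ρ t) _).1 rfl
  have hsat := hI _ (hrun.reachable t)
  have hstep := hU.expected_decrease _ (ρ t).2 (hen.1.symm ▸ hsat) hen.2 fun ℓ hℓ =>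
    integrable_nextLaw_of_stepKernel C hρ ℓ hℓ
  rw [hen.1] at hstep
  rw [integral_stepKernel C hρ, process]
  linarith

theorem IsLESM.monotone_integral_process {I : PredicateFunction L n} (hI : C.IsInvariant I)
    {f : (Fin m → ℝ) → ℝ} (hf : Measurable f) {Λ : StateFunction L n} (hΛ : C.IsLESM I f Λ)
    (hint : ∀ i, Integrable (C.process Λ f i) C.runMeasure) :
    Monotone fun i => ∫ ρ, C.process Λ f i ρ ∂C.runMeasure := by
  refine monotone_nat_of_le_succ fun t => ?_
  obtain ⟨h₁, h₂, h₃⟩ := ae_integrable_stepKernel (measurable_stateFunction_add (C := C) Λ hf)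
    (hint (t + 1))
  refine (integral_mono_ae (hint t) h₂ ?_).trans_eq h₃.symm
  filter_upwards [h₁, C.ae_isRun] with ρ hρ hrun
  have hen := (C.enabledTransition_eq_iff (ρ t) _).1 rfl
  have hsat := hI _ (hrun.reachable t)
  have hstep := hΛ.expected_increase _ (ρ t).2 (hen.1.symm ▸ hsat) hen.2 fun ℓ hℓ =>
    integrable_nextLaw_of_stepKernel C hρ ℓ hℓ
  rw [hen.1] at hstep
  rw [integral_stepKernel C hρ, process]
  linarith

theorem measurableSet_lt_timeTerm (t : ℕ) :
    MeasurableSet {ρ : ℕ → State L n | (t : ℕ∞) < C.timeTerm ρ} :=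
  C.measurable_timeTerm (MeasurableSet.of_discrete (s := Set.Ioi (t : ℕ∞)))

/-- The event `{T > t}` is decided by `Z_0, …, Z_t`, so conditional expectations given these states
may be integrated over it. -/
theorem measurableSet_piLE_lt_timeTerm {L : Type*} [MeasurableSpace L]
    [DiscreteMeasurableSpace L] {n m : ℕ} {C : PCFG L n m} (t : ℕ) :
    MeasurableSet[Filtration.piLE (X := fun _ : ℕ => State L n) t]
      {ρ : ℕ → State L n | (t : ℕ∞) < C.timeTerm ρ} := by
  refine ⟨{x | ∀ i : Set.Iic t, (x i).1 ≠ C.locOut}, ?_, ?_⟩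
  · rw [Set.ofPred_forall]
    exact MeasurableSet.iInter fun i => (measurable_fst.comp (measurable_pi_apply i))
      (MeasurableSet.of_discrete (s := {ℓ : L | ℓ ≠ C.locOut}))
  · ext ρ
    simp only [Set.mem_preimage, Set.mem_ofPred_eq, lt_timeTerm_iff]
    exact ⟨fun h i hi => h ⟨i, hi⟩, fun h i => h i i.2⟩

/-- The process only moves before termination. -/
theorem integral_abs_increment_eq_setIntegral {I : PredicateFunction L n} (hI : C.IsInvariant I)
    {f : (Fin m → ℝ) → ℝ} {η : StateFunction L n}
    (hη : ∀ x, (I C.locOut).Sat x → (η C.locOut).eval x = 0) (t : ℕ) :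
    ∫ ρ, |C.process η f (t + 1) ρ - C.process η f t ρ| ∂C.runMeasure =
      ∫ ρ in {ρ | (t : ℕ∞) < C.timeTerm ρ},
        |C.process η f (t + 1) ρ - C.process η f t ρ| ∂C.runMeasure := by
  rw [← integral_indicator (measurableSet_lt_timeTerm t)]
  refine integral_congr_ae ?_
  filter_upwards [C.ae_isRun] with ρ hρ
  by_cases h : (t : ℕ∞) < C.timeTerm ρ
  · rw [Set.indicator_of_mem (show ρ ∈ {ρ | (t : ℕ∞) < C.timeTerm ρ} from h)]
  · rw [Set.indicator_of_notMem (show ρ ∉ {ρ | (t : ℕ∞) < C.timeTerm ρ} from h)]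
    have h' := not_lt.1 h
    rw [hρ.process_eq_output hI hη f h', hρ.process_eq_output hI hη f
      (h'.trans (by exact_mod_cast Nat.le_succ t)), sub_self, abs_zero]

theorem AlmostSurelyTerminating.ae_timeTerm_ne_top (hC : C.AlmostSurelyTerminating) :
    ∀ᵐ ρ ∂C.runMeasure, C.timeTerm ρ ≠ ⊤ := by
  have h : ∀ᵐ ρ ∂C.runMeasure, ∃ i, (ρ i).1 = C.locOut := by
    refine (mem_ae_iff_prob_eq_one ?_).2 hC
    rw [Set.ofPred_exists]
    exact MeasurableSet.iUnion fun i => (measurable_fst.comp (measurable_pi_apply i))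
      (MeasurableSet.of_discrete (s := {C.locOut}))
  filter_upwards [h] with ρ ⟨i, hi⟩
  exact ne_top_of_le_ne_top (ENat.natCast_ne_top i) (timeTerm_le_of_locOut hi)

/-- The tail formula `E[T] = ∑ P(T > t)`, of which only `≥` is needed: where `T = k`, the indicators
of `{T > t}` vanish for `t ≥ k`. -/
theorem summable_measureReal_lt_timeTerm (hC : C.AlmostSurelyTerminating)
    (hT : ∫⁻ ρ, (C.timeTerm ρ : ℝ≥0∞) ∂C.runMeasure < ⊤) :
    Summable fun t : ℕ => C.runMeasure.real {ρ | (t : ℕ∞) < C.timeTerm ρ} := by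
  refine ENNReal.summable_toReal ?_
  have h : ∀ t : ℕ, C.runMeasure {ρ | (t : ℕ∞) < C.timeTerm ρ} =
      ∫⁻ ρ, Set.indicator {ρ | (t : ℕ∞) < C.timeTerm ρ} 1 ρ ∂C.runMeasure := fun t =>
    (lintegral_indicator_one (measurableSet_lt_timeTerm t)).symm
  simp only [h]
  rw [← lintegral_tsum fun t =>
    (measurable_one.indicator (measurableSet_lt_timeTerm t)).aemeasurable]
  refine ((lintegral_mono_ae ?_).trans_lt hT).ne
  filter_upwards [hC.ae_timeTerm_ne_top] with ρ hρ
  obtain ⟨k, hk, -⟩ := exists_timeTerm_eq hρ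
  rw [tsum_eq_sum (s := Finset.range k) fun t ht => Set.indicator_of_notMem
    (show ρ ∉ {ρ | (t : ℕ∞) < C.timeTerm ρ} by simpa [hk] using ht) _, hk]
  calc ∑ t ∈ Finset.range k, Set.indicator {ρ | (t : ℕ∞) < C.timeTerm ρ} (1 : (ℕ → State L n) → ℝ≥0∞) ρ
      ≤ ∑ _t ∈ Finset.range k, 1 :=
        Finset.sum_le_sum fun t _ => Set.indicator_le_self' (fun _ _ => zero_le) ρ
    _ = _ := by simp

/-- For `t ≥ c` the event `{T > t}` is null, so only finitely many terms are nonzero. -/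
theorem OSTC1.summable_increments (h : C.OSTC1) {I : PredicateFunction L n}
    (hI : C.IsInvariant I) {f : (Fin m → ℝ) → ℝ} {η : StateFunction L n}
    (hη : ∀ x, (I C.locOut).Sat x → (η C.locOut).eval x = 0) :
    Summable fun t => ∫ ρ, |C.process η f (t + 1) ρ - C.process η f t ρ| ∂C.runMeasure := by
  obtain ⟨c, hc⟩ := h
  refine summable_of_ne_finset_zero (s := Finset.range c) fun t ht => ?_
  rw [integral_abs_increment_eq_setIntegral hI hη]
  refine setIntegral_measure_zero _ (measure_mono_null ?_ (ae_iff.1 hc))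
  intro ρ hρ hle
  have hct : (c : ℕ∞) ≤ t := by exact_mod_cast not_lt.1 (fun h => ht (Finset.mem_range.2 h))
  exact (hρ.trans_le (hle.trans hct)).false

/-- Over `{T > t}`, which lies in `F_t`, the increment may be replaced by its conditional
expectation. The `t`-th term is thus at most `P(T > t) * c`, summable because `E[T]` is finite. -/
theorem OSTC3.summable_increments {η : StateFunction L n} {f : (Fin m → ℝ) → ℝ}
    (h : C.OSTC3 η f) (hC : C.AlmostSurelyTerminating) {I : PredicateFunction L n}
    (hI : C.IsInvariant I) (hη : ∀ x, (I C.locOut).Sat x → (η C.locOut).eval x = 0)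
    (hint : ∀ i, Integrable (C.process η f i) C.runMeasure) :
    Summable fun t => ∫ ρ, |C.process η f (t + 1) ρ - C.process η f t ρ| ∂C.runMeasure := by
  obtain ⟨hT, -, c, hc⟩ := h
  refine .of_nonneg_of_le (fun t => integral_nonneg fun _ => abs_nonneg _) (fun t => ?_)
    ((summable_measureReal_lt_timeTerm hC hT).mul_right c)
  have hi : Integrable (fun ρ => |C.process η f (t + 1) ρ - C.process η f t ρ|) C.runMeasure :=
    ((hint (t + 1)).sub (hint t)).abs
  rw [integral_abs_increment_eq_setIntegral hI hη, ← setIntegral_condExp (Filtration.le _ t) hi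
    (measurableSet_piLE_lt_timeTerm t), ← smul_eq_mul, ← setIntegral_const]
  exact setIntegral_mono_ae integrable_condExp.integrableOn (integrable_const c).integrableOn (hc t)

/-- A polynomial bound on the increment times an exponentially small `P(T > t)` is summable. -/
theorem OSTC4.summable_increments {η : StateFunction L n} {f : (Fin m → ℝ) → ℝ}
    (h : C.OSTC4 η f) {I : PredicateFunction L n}
    (hI : C.IsInvariant I) (hη : ∀ x, (I C.locOut).Sat x → (η C.locOut).eval x = 0)
    (hint : ∀ i, Integrable (C.process η f i) C.runMeasure) :
    Summable fun t => ∫ ρ, |C.process η f (t + 1) ρ - C.process η f t ρ| ∂C.runMeasure := by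
  obtain ⟨M, c₁, c₂, d, hc₂, htail, hM⟩ := h
  -- The natural exponent `⌈d⌉₊` majorises the real exponent `d` for `t ≥ 1`, also when `d` is
  -- negative; absolute values are taken because `M` and `c₁` carry no sign assumption.
  have hsum : Summable fun t : ℕ => |M| * |c₁| * ((t : ℝ) ^ ⌈d⌉₊ * Real.exp (-c₂ * t)) :=
    (Real.summable_pow_mul_exp_neg_nat_mul ⌈d⌉₊ hc₂).mul_left _
  refine summable_of_isBigO_nat hsum (Asymptotics.IsBigO.of_bound 1 ?_)
  filter_upwards [htail, eventually_ge_atTop 1] with t ht h1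
  have h1' : (1 : ℝ) ≤ t := by exact_mod_cast h1
  have hpow : (t : ℝ) ^ d ≤ (t : ℝ) ^ ⌈d⌉₊ := by
    rw [← Real.rpow_natCast]
    exact Real.rpow_le_rpow_of_exponent_le h1' (Nat.le_ceil d)
  rw [one_mul, Real.norm_of_nonneg (integral_nonneg fun _ => abs_nonneg _),
    Real.norm_of_nonneg (by positivity), integral_abs_increment_eq_setIntegral hI hη]
  calc _ ≤ ∫ ρ in {ρ | (t : ℕ∞) < C.timeTerm ρ}, |M| * (t : ℝ) ^ ⌈d⌉₊ ∂C.runMeasure := by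
        refine setIntegral_mono_ae ((hint (t + 1)).sub (hint t)).abs.integrableOn
          (integrable_const _).integrableOn ?_
        filter_upwards [hM t h1] with ρ hρ
        calc _ ≤ M * (t : ℝ) ^ d := hρ
          _ ≤ |M| * (t : ℝ) ^ d := by gcongr; exact le_abs_self M
          _ ≤ _ := by gcongr
    _ = C.runMeasure.real {ρ | (t : ℕ∞) < C.timeTerm ρ} * (|M| * (t : ℝ) ^ ⌈d⌉₊) := by
        rw [setIntegral_const, smul_eq_mul]
    _ ≤ |c₁| * Real.exp (-c₂ * t) * (|M| * (t : ℝ) ^ ⌈d⌉₊) := by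
        gcongr
        exact ht.trans (by gcongr; exact le_abs_self c₁)
    _ = _ := by ring

/-- Optional stopping: under OST-soundness the process converges in mean to the value of `f` at
the output. -/
theorem OSTSound.tendsto_integral_process (hC : C.AlmostSurelyTerminating)
    {I : PredicateFunction L n} (hI : C.IsInvariant I) {f : (Fin m → ℝ) → ℝ} (hf : Measurable f)
    {η : StateFunction L n} (hη : ∀ x, (I C.locOut).Sat x → (η C.locOut).eval x = 0)
    (h : C.OSTSound η f) :
    Integrable (fun ρ => f (C.output ρ)) C.runMeasure ∧
      Tendsto (fun i => ∫ ρ, C.process η f i ρ ∂C.runMeasure) atTop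
        (nhds (∫ ρ, f (C.output ρ) ∂C.runMeasure)) := by
  obtain ⟨hint, h⟩ := h
  have hg : AEStronglyMeasurable (fun ρ => f (C.output ρ)) C.runMeasure :=
    (hf.comp C.measurable_output).aestronglyMeasurable
  have hlim : ∀ᵐ ρ ∂C.runMeasure, ∃ i, ∀ j, i ≤ j → C.process η f j ρ = f (C.output ρ) := by
    filter_upwards [C.ae_isRun, hC.ae_timeTerm_ne_top] with ρ hρ hT
    obtain ⟨k, hk, -⟩ := exists_timeTerm_eq hT
    exact ⟨k, fun j hj => hρ.process_eq_output hI hη f (hk ▸ by exact_mod_cast hj)⟩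
  rcases h with h | ⟨c, hc⟩ | h | h
  · exact tendsto_integral_of_summable_increments hint hg (h.summable_increments hI hη) hlim
  -- (C2) bounds every run, hence almost every trajectory, by a constant, which is integrable for a
  -- probability measure.
  · have hbd : ∀ᵐ ρ ∂C.runMeasure, ∀ t, ‖C.process η f t ρ‖ ≤ c := by
      filter_upwards [C.ae_isRun] with ρ hρ t
      rw [← hρ.process_min_timeTerm]
      exact hc t ρ hρ
    refine ⟨(integrable_const c).mono' hg ?_, tendsto_integral_of_dominated_convergence _
      (fun i => (hint i).1) (integrable_const c) (fun i => hbd.mono fun ρ h => h i) ?_⟩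
    · filter_upwards [hbd, hlim] with ρ h ⟨i, hi⟩
      rw [← hi i le_rfl]
      exact h i
    · filter_upwards [hlim] with ρ ⟨i, hi⟩
      exact tendsto_const_nhds.congr' (eventually_atTop.2 ⟨i, fun j hj => (hi j hj).symm⟩)
  · exact tendsto_integral_of_summable_increments hint hg
      (h.summable_increments hC hI hη hint) hlim
  · exact tendsto_integral_of_summable_increments hint hg (h.summable_increments hI hη hint) hlim

end Soundness

end PCFG

theorem theorem1 {L : Type*} [Fintype L] [MeasurableSpace L] [DiscreteMeasurableSpace L]
    {n m : ℕ} (C : PCFG L n m) (hC : C.AlmostSurelyTerminating)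
    (f : (Fin m → ℝ) → ℝ) (hf : Measurable f)
    (Uf Lf : StateFunction L n) (I J : PredicateFunction L n)
    (hI : C.IsInvariant I) (hJ : C.IsInvariant J)
    (hU : C.IsUESM I f Uf) (hL : C.IsLESM J f Lf)
    (hUsound : C.OSTSound Uf f) (hLsound : C.OSTSound Lf f) :
    Integrable f C.outputDist ∧
      (Uf C.locInit).eval C.valInit + f (C.proj C.valInit) ≥ ∫ y, f y ∂C.outputDist ∧
      (Lf C.locInit).eval C.valInit + f (C.proj C.valInit) ≤ ∫ y, f y ∂C.outputDist := by
  obtain ⟨hint, hlimU⟩ := hUsound.tendsto_integral_process hC hI hf hU.zero_on_output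
  obtain ⟨-, hlimL⟩ := hLsound.tendsto_integral_process hC hJ hf hL.zero_on_output
  have hmap : ∫ y, f y ∂C.outputDist = ∫ ρ, f (C.output ρ) ∂C.runMeasure :=
    integral_map C.measurable_output.aemeasurable hf.aestronglyMeasurable
  refine ⟨(integrable_map_measure hf.aestronglyMeasurable
    C.measurable_output.aemeasurable).2 hint, ?_, ?_⟩
  · rw [hmap, ← PCFG.integral_process_zero]
    -- An antitone sequence lies above its limit; its term at index `0` is the value at the
    -- deterministic initial state.
    exact (hU.antitone_integral_process hI hf hUsound.1).le_of_tendsto hlimU 0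
  · rw [hmap, ← PCFG.integral_process_zero]
    exact (hL.monotone_integral_process hJ hf hLsound.1).ge_of_tendsto hlimL 0
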